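/- Let $X$ be a measurable space of inputs and let $Y=\{\mathrm t,\mathrm f,\mathrm{idk}\}$ be the set of verdicts (True, False, "I don't know"). Let $\mathcal D_S,\mathcal D_T$ be probability distributions on $X\times Y$ (for example, uniform distributions on finite training and evaluation datasets). Let $\mathcal H_{\mathrm t},\mathcal H_{\mathrm f},\mathcal H_{\mathrm{idk}}$ be classes of measurable functions $X\to\{0,1\}$, each of VC dimension at most $d\in\mathbb N$. Let $\mathcal H$ be the set of all triples $h=(h_{\mathrm t},h_{\mathrm f},h_{\mathrm{idk}})$ with $h_i\in\mathcal H_i$ and $h_{\mathrm t}(x)+h_{\mathrm f}(x)+h_{\mathrm{idk}}(x)=1$ for all $x\in X$. For a distribution $\mathcal D$ on $X\times Y$, for $i\in Y$ and $g:X\to\{0,1\}$, and for $h\in\mathcal H$, put $$L_{\mathcal D}^{i}(g)=\mathbb E_{(x,y)\sim\mathcal D}\,\bigl|g(x)-\mathbf 1[y=i]\bigr|,\qquad L_{\mathcal D}(h)=\tfrac12\sum_{i\in Y}L_{\mathcal D}^{i}(h_i),$$ so that $L_{\mathcal D}(h)$ is the misclassification rate of $h$. Let $$\lambda=\inf_{h\in\mathcal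 H}\ \sum_{i\in Y}\bigl(L_{\mathcal D_S}^{i}(h_i)+L_{\mathcal D_T}^{i}(h_i)\bigr)$$ be the optimal combined error (the total loss of the three components, on source plus target). For $u,v\in X^m$ let $$d_{\mathcal H\Delta\mathcal H}(u,v)=2\,\sup_{i\in Y}\ \sup_{g,g'\in\mathcal H_i}\left|\frac{\#\{j: g(u_j)\ne g'(u_j)\}}{m}-\frac{\#\{j: g(v_j)\ne g'(v_j)\}}{m}\right|.$$ Let $m\ge1$, and let $\mathcal U_S,\mathcal U_T$ be independent samples of $m$ independent draws each from $\mathcal D_S$ and $\mathcal D_T$, respectively; $d_{\mathcal H\Delta\mathcal H}(\mathcal U_S,\mathcal U_T)$ is formed from their inputs. Assume, as usual, that for $\mathcal D=\mathcal D_S$ and for $\mathcal D=\mathcal D_T$ the divergence $d_{\mathcal H\Delta\mathcal H}$ of two independent samples of size $m$ from $\mathcal D$ is measurable up to null sets. Then for every $\delta\in(0,1)$, with probability at least $1-\delta$, every $h\in\mathcal H$ satisfies $$L_{\mathcal D_T}(h)\le L_{\mathcal D_S}(h)+\tfrac34\,d_{\mathcal H\Delta\mathcal H}(\mathcal U_S,\mathcal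 U_T)+6\sqrt{\frac{2d\log(2m)+\log(2/\delta)}{m}}+\tfrac12\lambda .$$ (That is, the event that some $h\in\mathcal H$ violates this has outer probability at most $\delta$.) -/

import Mathlib

open MeasureTheory

namespace Judge

/-- The three possible verdicts on an input: True, False, "I don't know". -/
inductive Verdict where
  | t
  | f
  | idk
  deriving DecidableEq

instance : Fintype Verdict where
  elems := {Verdict.t, Verdict.f, Verdict.idk}
  complete := by intro x; cases x <;> simp

instance : MeasurableSpace Verdict := ⊤

/-- The real number `0` or `1` that belongs to a truth value. -/
def bit (b : Bool) : ℝ := if b then 1 else 0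

/-- A finite set `s` is shattered by a class `H` of binary hypotheses. -/
def Shatters {X : Type*} (H : Set (X → Bool)) (s : Finset X) : Prop :=
  ∀ t ⊆ s, ∃ g ∈ H, ∀ x ∈ s, (g x = true ↔ x ∈ t)

/-- The Vapnik-Chervonenkis dimension: the supremum of the sizes of the shattered finite sets. -/
noncomputable def vcDim {X : Type*} (H : Set (X → Bool)) : ℕ∞ :=
  ⨆ (s : Finset X) (_ : Shatters H s), (s.card : ℕ∞)

/-- The portfolios `h = (h_t, h_f, h_idk)` with `h_i` in `H_i` that give exactly one verdict on
every input, that is `h_t x + h_f x + h_idk x = 1`. -/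
def portfolios {X : Type*} (H : Verdict → Set (X → Bool)) : Set (Verdict → X → Bool) :=
  {h | (∀ i, h i ∈ H i) ∧ ∀ x, ∑ i, bit (h i x) = 1}

/-- The expected loss `E |g x - 1(y = i)|`, for `(x, y)` drawn from `D`, of a binary hypothesis `g`
that is to predict whether the verdict is `i`. -/
noncomputable def componentLoss {X : Type*} [MeasurableSpace X] (D : Measure (X × Verdict))
    (i : Verdict) (g : X → Bool) : ℝ :=
  ∫ p, |bit (g p.1) - bit (decide (p.2 = i))| ∂D

/-- The misclassification rate of a portfolio: half the sum of its component losses. -/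
noncomputable def misclassification {X : Type*} [MeasurableSpace X] (D : Measure (X × Verdict))
    (h : Verdict → X → Bool) : ℝ :=
  (1 / 2) * ∑ i, componentLoss D i (h i)

/-- The optimal combined error: the infimum over all portfolios of the total loss of the three
components, source plus target. -/
noncomputable def optimalCombinedError {X : Type*} [MeasurableSpace X]
    (DS DT : Measure (X × Verdict)) (H : Verdict → Set (X → Bool)) : ℝ :=
  sInf ((fun h => ∑ i, (componentLoss DS i (h i) + componentLoss DT i (h i))) '' portfolios H)

/-- The symmetric difference class: all `g xor g'` with `g`, `g'` in the same one of the three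
hypothesis spaces. -/
def symmDiffClass {X : Type*} (H : Verdict → Set (X → Bool)) : Set (X → Bool) :=
  {a | ∃ i, ∃ g ∈ H i, ∃ g' ∈ H i, a = fun x => xor (g x) (g' x)}

/-- The inputs of a labelled sample. -/
def inputs {X : Type*} {m : ℕ} (U : Fin m → X × Verdict) : Fin m → X := fun j => (U j).1

/-- The fraction of the sample points at which `a` is true. -/
noncomputable def frequency {X : Type*} {m : ℕ} (a : X → Bool) (u : Fin m → X) : ℝ :=
  (∑ j, bit (a (u j))) / m

/-- The empirical divergence of two samples with respect to the symmetric difference class. -/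
noncomputable def empiricalDivergence {X : Type*} {m : ℕ} (H : Verdict → Set (X → Bool))
    (u v : Fin m → X) : ℝ :=
  2 * sSup ((fun a => |frequency a u - frequency a v|) '' symmDiffClass H)

/-- The law of `m` independent draws from `D`. -/
noncomputable def sampleLaw {X : Type*} [MeasurableSpace X] (D : Measure (X × Verdict)) (m : ℕ) :
    Measure (Fin m → X × Verdict) :=
  Measure.pi fun _ => D

/-- The empirical divergence of two independent samples of size `m` from `D` is a random variable,
that is, measurable up to null sets. -/
def DivergenceMeasurable {X : Type*} [MeasurableSpace X] (D : Measure (X × Verdict))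
    (H : Verdict → Set (X → Bool)) (m : ℕ) : Prop :=
  AEMeasurable
    (fun U : (Fin m → X × Verdict) × (Fin m → X × Verdict) =>
      empiricalDivergence H (inputs U.1) (inputs U.2))
    ((sampleLaw D m).prod (sampleLaw D m))

end Judge

namespace Judge

/-! Compare `h` with any portfolio `k`. By the triangle inequality, the target loss of `h i` is at
most that of `k i` plus the target probability that they disagree. The source probability of
disagreement is at most the sum of the two source losses. Hence a bound `c` for the source-target
difference of disagreement probabilities costs `c` per component. Summing three components, halving
and taking the infimum over `k` gives `3 / 2 * c` and half the optimal combined error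
(`misclassification_le_add`).

To find `c`, replace each probability by its sample frequency, with error at most `2 * s`, where `s`
is `deviationRadius`. This gives `c = d_HΔH / 2 + 4 * s`. Each of the two replacements fails with
probability at most `δ / 2` (`sampleLaw_deviation_le`).

That uniform deviation bound comes from exponential moments: Jensen's inequality brings in a ghost
sample, random exchanges between the samples turn frequency gaps into signed sums, Sauer-Shelah
leaves finitely many of these, and Markov's inequality concludes. -/

/-! ### Growth of the hypothesis classes and their symmetric differences -/

lemma sum_choose_le_succ_pow (n d : ℕ) : ∑ k ∈ Finset.Iic d, n.choose k ≤ (n + 1) ^ d := by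
  have hI : Finset.Iic d = Finset.range (d + 1) := by
    ext k
    simp
  rw [add_pow, hI]
  refine Finset.sum_le_sum fun k hk => ?_
  have hkd : k ≤ d := Nat.lt_succ_iff.1 (Finset.mem_range.1 hk)
  calc n.choose k ≤ n ^ k := Nat.choose_le_pow n k
    _ ≤ n ^ k * 1 ^ (d - k) * d.choose k := by
      rw [one_pow, mul_one]
      exact Nat.le_mul_of_pos_right _ (Nat.choose_pos hkd)

lemma card_le_of_vcDim_le {X : Type*} {H : Set (X → Bool)} {d : ℕ} (hd : vcDim H ≤ d)
    {s : Finset X} (hs : Shatters H s) : s.card ≤ d := by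
  have h : (s.card : ℕ∞) ≤ vcDim H :=
    le_iSup₂ (f := fun (s : Finset X) (_ : Shatters H s) => (s.card : ℕ∞)) s hs
  exact_mod_cast h.trans hd

/-- **Sauer-Shelah** for the restrictions of a class to a finite family of points. -/
lemma exists_finset_restrictions {X ι : Type*} [Fintype ι] [DecidableEq ι] {H : Set (X → Bool)}
    {d : ℕ} (hd : vcDim H ≤ d) (x : ι → X) :
    ∃ B : Finset (ι → Bool), B.card ≤ (Fintype.card ι + 1) ^ d ∧
      ∀ g ∈ H, (fun j => g (x j)) ∈ B := by
  classical
  let 𝒜 : Finset (Finset ι) := {t | ∃ g ∈ H, t = Finset.univ.filter fun j => g (x j) = true}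
  have hvc : 𝒜.vcDim ≤ d := by
    refine Finset.sup_le fun s hs => ?_
    rw [Finset.mem_shatterer] at hs
    -- The points may repeat, but a shattered index set has distinct points: some `g` is true at `a`
    -- and at no other index of `s`.
    have hinj : Set.InjOn x s := by
      intro a ha b hb hab
      obtain ⟨t, ht, hst⟩ := hs (Finset.singleton_subset_iff.2 ha)
      obtain ⟨g, -, rfl⟩ := (Finset.mem_filter.1 ht).2
      have h1 : a ∈ s ∩ Finset.univ.filter fun j => g (x j) = true := by simp [hst]
      have h2 : b ∈ s ∩ Finset.univ.filter fun j => g (x j) = true := by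
        simp only [Finset.mem_inter, Finset.mem_filter, Finset.mem_univ, true_and] at h1 ⊢
        exact ⟨hb, hab ▸ h1.2⟩
      rw [hst] at h2
      exact (Finset.mem_singleton.1 h2).symm
    have hsh : Shatters H (s.image x) := by
      intro t _
      obtain ⟨r, hr, hsr⟩ := hs (Finset.filter_subset (fun j => x j ∈ t) s)
      obtain ⟨g, hg, rfl⟩ := (Finset.mem_filter.1 hr).2
      refine ⟨g, hg, fun y hy => ?_⟩
      obtain ⟨j, hj, rfl⟩ := Finset.mem_image.1 hy
      have := Finset.ext_iff.1 hsr j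
      simpa [hj] using this
    have := card_le_of_vcDim_le hd hsh
    rwa [Finset.card_image_of_injOn hinj] at this
  refine ⟨𝒜.image fun t j => decide (j ∈ t), ?_, fun g hg => Finset.mem_image.2
    ⟨Finset.univ.filter fun j => g (x j) = true, ?_, ?_⟩⟩
  · calc _ ≤ 𝒜.card := Finset.card_image_le
      _ ≤ ∑ k ∈ Finset.Iic 𝒜.vcDim, (Fintype.card ι).choose k :=
        𝒜.card_le_card_shatterer.trans Finset.card_shatterer_le_sum_vcDim
      _ ≤ (Fintype.card ι + 1) ^ 𝒜.vcDim := sum_choose_le_succ_pow _ _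
      _ ≤ _ := Nat.pow_le_pow_right (Nat.succ_pos _) hvc
  · exact Finset.mem_filter.2 ⟨Finset.mem_univ _, g, hg, rfl⟩
  · ext j
    simp

lemma bit_nonneg (b : Bool) : 0 ≤ bit b := by cases b <;> simp [bit]

lemma bit_le_one (b : Bool) : bit b ≤ 1 := by cases b <;> simp [bit]

/-- The differences of the values of the functions of `A` at the points of two samples take at
most `N` values. -/
def HasDifferencePatterns {Z : Type*} (A : Set (Z → Bool)) (m N : ℕ) : Prop :=
  ∀ u v : Fin m → Z, ∃ B : Finset (Fin m → ℝ), B.card ≤ N ∧ (∀ c ∈ B, ∀ j, |c j| ≤ 1) ∧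
    ∀ a ∈ A, (fun j => bit (a (u j)) - bit (a (v j))) ∈ B

/-- Sauer-Shelah on the `2 * m` joint points bounds the restrictions of each class. A pattern is
fixed by a pair of restrictions, hence the square, and by one of three classes. -/
lemma hasDifferencePatterns_symmDiffClass {X : Type*} {H : Verdict → Set (X → Bool)} {d : ℕ}
    (hd : ∀ i, vcDim (H i) ≤ d) (m : ℕ) :
    HasDifferencePatterns (symmDiffClass H) m (3 * (2 * m + 1) ^ (2 * d)) := by
  classical
  intro u v
  choose B hB hmem using fun i => exists_finset_restrictions (hd i) (Sum.elim u v)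
  let c : (Fin m ⊕ Fin m → Bool) × (Fin m ⊕ Fin m → Bool) → Fin m → ℝ := fun r j =>
    bit (xor (r.1 (.inl j)) (r.2 (.inl j))) - bit (xor (r.1 (.inr j)) (r.2 (.inr j)))
  refine ⟨Finset.univ.biUnion fun i => (B i ×ˢ B i).image c, ?_, ?_, ?_⟩
  · calc _ ≤ ∑ i : Verdict, ((B i ×ˢ B i).image c).card := Finset.card_biUnion_le
      _ ≤ ∑ _i : Verdict, (2 * m + 1) ^ (2 * d) := by
        refine Finset.sum_le_sum fun i _ => Finset.card_image_le.trans ?_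
        have h := hB i
        rw [Fintype.card_sum, Fintype.card_fin, ← two_mul] at h
        rw [Finset.card_product, two_mul d, pow_add]
        exact Nat.mul_le_mul h h
      _ = _ := by
        rw [Finset.sum_const, smul_eq_mul]
        rfl
  · intro b hb j
    simp only [Finset.mem_biUnion, Finset.mem_image, Finset.mem_univ, true_and] at hb
    obtain ⟨i, r, -, rfl⟩ := hb
    rw [abs_le]
    constructor <;> dsimp only [c] <;>
      linarith [bit_nonneg (xor (r.1 (.inl j)) (r.2 (.inl j))),
        bit_nonneg (xor (r.1 (.inr j)) (r.2 (.inr j))),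
        bit_le_one (xor (r.1 (.inl j)) (r.2 (.inl j))),
        bit_le_one (xor (r.1 (.inr j)) (r.2 (.inr j)))]
  · rintro a ⟨i, g, hg, g', hg', rfl⟩
    simp only [Finset.mem_biUnion, Finset.mem_image, Finset.mem_univ, true_and]
    exact ⟨i, (_, _), Finset.mem_product.2 ⟨hmem i g hg, hmem i g' hg'⟩, rfl⟩

/-! ### Symmetrization and the uniform deviation bound -/

section UniformDeviation

variable {Z : Type*} {m : ℕ}

lemma frequency_nonneg (a : Z → Bool) (u : Fin m → Z) : 0 ≤ frequency a u :=
  div_nonneg (Finset.sum_nonneg fun _ _ => bit_nonneg _) (Nat.cast_nonneg m)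

lemma frequency_le_one (a : Z → Bool) (u : Fin m → Z) : frequency a u ≤ 1 := by
  refine div_le_one_of_le₀ ?_ (Nat.cast_nonneg m)
  simpa using Finset.sum_le_sum fun j (_ : j ∈ Finset.univ) => bit_le_one (a (u j))

lemma abs_frequency_sub_le_one (a : Z → Bool) (u v : Fin m → Z) :
    |frequency a u - frequency a v| ≤ 1 :=
  abs_sub_le_of_nonneg_of_le (frequency_nonneg a u) (frequency_le_one a u)
    (frequency_nonneg a v) (frequency_le_one a v)

/-- The largest difference of frequencies in two samples, over the functions of `A`. -/
noncomputable def maxFrequencyGap (A : Set (Z → Bool)) (u v : Fin m → Z) : ℝ :=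
  sSup ((fun a => |frequency a u - frequency a v|) '' A)

lemma abs_frequency_sub_le_maxFrequencyGap {A : Set (Z → Bool)} {a : Z → Bool} (ha : a ∈ A)
    (u v : Fin m → Z) : |frequency a u - frequency a v| ≤ maxFrequencyGap A u v := by
  refine le_csSup ⟨1, ?_⟩ ⟨a, ha, rfl⟩
  rintro _ ⟨b, -, rfl⟩
  exact abs_frequency_sub_le_one b u v

/-- Exchange the coordinates of two samples at the places where `σ` is true. -/
def exchange (σ : Fin m → Bool) (p : (Fin m → Z) × (Fin m → Z)) : (Fin m → Z) × (Fin m → Z) :=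
  (fun j => if σ j then p.2 j else p.1 j, fun j => if σ j then p.1 j else p.2 j)

lemma frequency_exchange_sub (σ : Fin m → Bool) (p : (Fin m → Z) × (Fin m → Z)) (a : Z → Bool) :
    frequency a (exchange σ p).1 - frequency a (exchange σ p).2 =
      ∑ j, (if σ j then -1 else 1) * ((bit (a (p.1 j)) - bit (a (p.2 j))) / m) := by
  rw [frequency, frequency, ← sub_div, ← Finset.sum_sub_distrib, Finset.sum_div]
  refine Finset.sum_congr rfl fun j _ => ?_
  cases h : σ j <;> (simp [exchange, h]; try ring)

/-- The sum over signs factors over the coordinates into terms `2 * cosh (c j)`, and `cosh x ≤ exp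
(x ^ 2 / 2)`. -/
lemma sum_exp_signed_sum_le (c : Fin m → ℝ) (b : ℝ) (hc : ∀ j, |c j| ≤ b) :
    ∑ σ : Fin m → Bool, Real.exp (∑ j, (if σ j then -1 else 1) * c j) ≤
      2 ^ m * Real.exp (m * (b ^ 2 / 2)) := by
  calc ∑ σ : Fin m → Bool, Real.exp (∑ j, (if σ j then -1 else 1) * c j)
      = ∏ j, ∑ s : Bool, Real.exp ((if s then -1 else 1) * c j) := by
        rw [Finset.prod_univ_sum, Fintype.piFinset_univ]
        exact Finset.sum_congr rfl fun σ _ => Real.exp_sum _ _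
    _ ≤ ∏ _j : Fin m, (2 * Real.exp (b ^ 2 / 2)) := by
        refine Finset.prod_le_prod (fun j _ => Finset.sum_nonneg fun s _ => (Real.exp_pos _).le)
          fun j _ => ?_
        have h1 : ∑ s : Bool, Real.exp ((if s then -1 else 1) * c j) = 2 * Real.cosh (c j) := by
          rw [Real.cosh_eq]
          simp
          ring
        have h2 : c j ^ 2 ≤ b ^ 2 := sq_le_sq' (abs_le.1 (hc j)).1 (abs_le.1 (hc j)).2
        rw [h1]
        have h3 := Real.cosh_le_exp_half_sq (c j)
        have h4 : Real.exp (c j ^ 2 / 2) ≤ Real.exp (b ^ 2 / 2) := by gcongr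
        linarith
    _ = _ := by
        rw [Finset.prod_const, Finset.card_univ, Fintype.card_fin, mul_pow, ← Real.exp_nat_mul]

/-- A union bound for fixed samples: the exponential of the largest gap is at most the sum over all
patterns and both signs of the absolute value, hence the factor `2 * N`. -/
lemma sum_exp_maxFrequencyGap_exchange_le {A : Set (Z → Bool)} {N : ℕ}
    (hA : HasDifferencePatterns A m N) (hne : A.Nonempty) (hm : 0 < m) {l : ℝ} (hl : 0 ≤ l)
    (p : (Fin m → Z) × (Fin m → Z)) :
    ∑ σ : Fin m → Bool,
        Real.exp (l * maxFrequencyGap A (exchange σ p).1 (exchange σ p).2) ≤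
      2 ^ m * (2 * N * Real.exp (l ^ 2 / (2 * m))) := by
  obtain ⟨B, hBN, hB1, hB⟩ := hA p.1 p.2
  let E : ℝ → (Fin m → ℝ) → (Fin m → Bool) → ℝ := fun s c σ =>
    Real.exp (∑ j, (if σ j then -1 else 1) * (s * l * (c j / m)))
  have hm' : (0 : ℝ) < m := Nat.cast_pos.2 hm
  have hE : ∀ s : ℝ, |s| = 1 → ∀ c ∈ B, ∑ σ, E s c σ ≤ 2 ^ m * Real.exp (l ^ 2 / (2 * m)) := by
    intro s hs c hc
    refine (sum_exp_signed_sum_le _ (l / m) fun j => ?_).trans_eq ?_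
    · rw [abs_mul, abs_mul, hs, one_mul, abs_div, abs_of_nonneg hl, abs_of_pos hm', ← mul_div_assoc]
      gcongr
      exact mul_le_of_le_one_right hl (hB1 c hc j)
    · congr 2
      field_simp
  have hpt : ∀ σ, Real.exp (l * maxFrequencyGap A (exchange σ p).1 (exchange σ p).2) ≤
      ∑ c ∈ B, (E 1 c σ + E (-1) c σ) := by
    intro σ
    let F : (Fin m → ℝ) → ℝ := fun c => |∑ j, (if σ j then -1 else 1) * (c j / m)|
    have hfin : ((fun a => |frequency a (exchange σ p).1 - frequency a (exchange σ p).2|) ''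
        A).Finite := by
      refine ((B.finite_toSet).image F).subset ?_
      rintro _ ⟨a, ha, rfl⟩
      refine ⟨_, hB a ha, ?_⟩
      dsimp only [F]
      rw [frequency_exchange_sub]
    obtain ⟨a, ha, hmax⟩ := (hne.image _).csSup_mem hfin
    rw [maxFrequencyGap, ← hmax]
    dsimp only
    rw [frequency_exchange_sub]
    refine le_trans ?_ (Finset.single_le_sum
      (f := fun c => E 1 c σ + E (-1) c σ) (fun c _ => by positivity) (hB a ha))
    have key : ∀ s : ℝ, s * l * ∑ j, (if σ j then -1 else 1) *
        ((bit (a (p.1 j)) - bit (a (p.2 j))) / m) = ∑ j, (if σ j then -1 else 1) *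
        (s * l * ((bit (a (p.1 j)) - bit (a (p.2 j))) / m)) := by
      intro s
      rw [Finset.mul_sum]
      exact Finset.sum_congr rfl fun j _ => by ring
    dsimp only [E]
    rw [← key, ← key]
    set S := ∑ j, (if σ j then -1 else 1) * ((bit (a (p.1 j)) - bit (a (p.2 j))) / (m : ℝ))
    rcases abs_cases S with ⟨h, -⟩ | ⟨h, -⟩ <;> rw [h]
    · rw [one_mul]
      exact le_add_of_nonneg_right (Real.exp_pos _).le
    · rw [show l * -S = -1 * l * S by ring]
      exact le_add_of_nonneg_left (Real.exp_pos _).le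
  calc _ ≤ ∑ σ, ∑ c ∈ B, (E 1 c σ + E (-1) c σ) := Finset.sum_le_sum fun σ _ => hpt σ
    _ = ∑ c ∈ B, (∑ σ, E 1 c σ + ∑ σ, E (-1) c σ) := by
      rw [Finset.sum_comm]
      exact Finset.sum_congr rfl fun c _ => Finset.sum_add_distrib
    _ ≤ ∑ _c ∈ B, (2 * (2 ^ m * Real.exp (l ^ 2 / (2 * m)))) := by
      refine Finset.sum_le_sum fun c hc => ?_
      linarith [hE 1 (by simp) c hc, hE (-1) (by simp) c hc]
    _ = B.card * (2 * (2 ^ m * Real.exp (l ^ 2 / (2 * m)))) := by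
      rw [Finset.sum_const, nsmul_eq_mul]
    _ ≤ N * (2 * (2 ^ m * Real.exp (l ^ 2 / (2 * m)))) := by gcongr
    _ = _ := by ring

variable [MeasurableSpace Z] (μ : Measure Z) [IsProbabilityMeasure μ]

/-- Seen as `m` independent pairs with law `μ.prod μ`, the samples are changed by swaps of single
pairs, which preserve that law. -/
lemma measurePreserving_exchange (σ : Fin m → Bool) :
    MeasurePreserving (exchange σ)
      ((Measure.pi fun _ : Fin m => μ).prod (Measure.pi fun _ : Fin m => μ))
      ((Measure.pi fun _ : Fin m => μ).prod (Measure.pi fun _ : Fin m => μ)) := by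
  have he := measurePreserving_arrowProdEquivProdArrow Z Z (Fin m) (fun _ => μ) (fun _ => μ)
  have hsw : MeasurePreserving
      (fun (w : Fin m → Z × Z) j => (if σ j then Prod.swap else id) (w j))
      (Measure.pi fun _ => μ.prod μ) (Measure.pi fun _ => μ.prod μ) := by
    refine measurePreserving_pi _ _ fun j => ?_
    cases σ j
    · exact MeasurePreserving.id _
    · exact Measure.measurePreserving_swap
  convert he.comp (hsw.comp he.symm) using 1
  ext p j <;> cases h : σ j <;>
    simp [exchange, h, MeasurableEquiv.arrowProdEquivProdArrow, Equiv.arrowProdEquivProdArrow]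

lemma lintegral_exp_maxFrequencyGap_le {A : Set (Z → Bool)} {N : ℕ}
    (hA : HasDifferencePatterns A m N) (hne : A.Nonempty) (hm : 0 < m) {l : ℝ} (hl : 0 ≤ l)
    (hmeas : AEMeasurable (fun p : (Fin m → Z) × (Fin m → Z) => maxFrequencyGap A p.1 p.2)
      ((Measure.pi fun _ => μ).prod (Measure.pi fun _ => μ))) :
    ∫⁻ p, ENNReal.ofReal (Real.exp (l * maxFrequencyGap A p.1 p.2))
        ∂((Measure.pi fun _ : Fin m => μ).prod (Measure.pi fun _ : Fin m => μ)) ≤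
      ENNReal.ofReal (2 * N * Real.exp (l ^ 2 / (2 * m))) := by
  set ρ := (Measure.pi fun _ : Fin m => μ).prod (Measure.pi fun _ : Fin m => μ)
  let f : (Fin m → Z) × (Fin m → Z) → ENNReal := fun p =>
    ENNReal.ofReal (Real.exp (l * maxFrequencyGap A p.1 p.2))
  have hf : AEMeasurable f ρ := by
    dsimp only [f]
    fun_prop
  have hswap : ∀ σ, ∫⁻ p, f (exchange σ p) ∂ρ = ∫⁻ p, f p ∂ρ := by
    intro σ
    have h := measurePreserving_exchange μ σ
    rw [← lintegral_map' (by rwa [h.map_eq]) h.measurable.aemeasurable, h.map_eq]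
  have hsum : (2 ^ m : ENNReal) * ∫⁻ p, f p ∂ρ ≤
      2 ^ m * ENNReal.ofReal (2 * N * Real.exp (l ^ 2 / (2 * m))) := by
    calc (2 ^ m : ENNReal) * ∫⁻ p, f p ∂ρ = ∑ σ : Fin m → Bool, ∫⁻ p, f (exchange σ p) ∂ρ := by
          simp [hswap]
      _ = ∫⁻ p, ∑ σ : Fin m → Bool, f (exchange σ p) ∂ρ :=
          (lintegral_finsetSum' _ fun σ _ =>
            hf.comp_quasiMeasurePreserving
              (measurePreserving_exchange μ σ).quasiMeasurePreserving).symm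
      _ ≤ ∫⁻ _, ENNReal.ofReal (2 ^ m * (2 * N * Real.exp (l ^ 2 / (2 * m)))) ∂ρ := by
          refine lintegral_mono fun p => ?_
          dsimp only [f]
          rw [← ENNReal.ofReal_sum_of_nonneg fun _ _ => (Real.exp_pos _).le]
          exact ENNReal.ofReal_le_ofReal (sum_exp_maxFrequencyGap_exchange_le hA hne hm hl p)
      _ = _ := by
          rw [lintegral_const, measure_univ, mul_one, ENNReal.ofReal_mul (by positivity)]
          congr 1
          rw [ENNReal.ofReal_pow (by norm_num)]
          simp
  exact (ENNReal.mul_le_mul_iff_right (by positivity) (by finiteness)).1 hsum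

lemma measurable_bit : Measurable bit := measurable_from_top

lemma measurable_frequency {a : Z → Bool} (ha : Measurable a) :
    Measurable (fun u : Fin m → Z => frequency a u) := by
  unfold frequency
  refine (Finset.measurable_sum _ fun j _ => ?_).div_const _
  exact measurable_bit.comp (ha.comp (measurable_pi_apply j))

lemma integrable_of_mem_Icc {W : Type*} [MeasurableSpace W] {ν : Measure W} [IsFiniteMeasure ν]
    {f : W → ℝ} (hf : Measurable f) {b : ℝ} (h : ∀ w, |f w| ≤ b) : Integrable f ν :=
  Integrable.of_bound hf.aestronglyMeasurable b (Filter.Eventually.of_forall h)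

lemma integrable_bit_comp {a : Z → Bool} (ha : Measurable a) : Integrable (fun z => bit (a z)) μ :=
  integrable_of_mem_Icc (b := 1) (measurable_bit.comp ha) fun z => by
    rw [abs_of_nonneg (bit_nonneg _)]
    exact bit_le_one _

lemma integral_frequency {a : Z → Bool} (ha : Measurable a) (hm : 0 < m) :
    ∫ u, frequency a u ∂(Measure.pi fun _ : Fin m => μ) = ∫ z, bit (a z) ∂μ := by
  have hm' : (m : ℝ) ≠ 0 := Nat.cast_ne_zero.2 hm.ne'
  have h : ∀ j : Fin m, ∫ u, bit (a (u j)) ∂(Measure.pi fun _ : Fin m => μ) =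
      ∫ z, bit (a z) ∂μ := by
    intro j
    have hp := measurePreserving_eval (fun _ : Fin m => μ) j
    conv_rhs => rw [← hp.map_eq]
    exact (integral_map hp.measurable.aemeasurable
      (measurable_bit.comp ha).aestronglyMeasurable).symm
  unfold frequency
  rw [integral_div, integral_finsetSum _ fun j _ => integrable_bit_comp (a := fun u : Fin m → Z => a (u j)) _
    (ha.comp (measurable_pi_apply j))]
  simp only [h, Finset.sum_const, Finset.card_univ, Fintype.card_fin, nsmul_eq_mul]
  field_simp

/-- Jensen's inequality for a ghost sample. -/
lemma exp_abs_integral_sub_frequency_le {A : Set (Z → Bool)} {a : Z → Bool} (haA : a ∈ A)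
    (ha : Measurable a) (hm : 0 < m) {l : ℝ} (hl : 0 ≤ l) (u : Fin m → Z) :
    ENNReal.ofReal (Real.exp (l * |∫ z, bit (a z) ∂μ - frequency a u|)) ≤
      ∫⁻ v, ENNReal.ofReal (Real.exp (l * maxFrequencyGap A u v))
        ∂(Measure.pi fun _ : Fin m => μ) := by
  set π := Measure.pi fun _ : Fin m => μ
  let f : (Fin m → Z) → ℝ := fun v => l * |frequency a u - frequency a v|
  have hfm : Measurable f :=
    ((measurable_const.sub (measurable_frequency ha)).abs).const_mul l
  have hfl : ∀ v, f v ≤ l := fun v =>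
    mul_le_of_le_one_right hl (abs_frequency_sub_le_one a u v)
  have hf0 : ∀ v, 0 ≤ f v := fun v => mul_nonneg hl (abs_nonneg _)
  have hfi : Integrable f π := integrable_of_mem_Icc hfm fun v => by
    rw [abs_of_nonneg (hf0 v)]
    exact hfl v
  have hei : Integrable (Real.exp ∘ f) π :=
    integrable_of_mem_Icc (b := Real.exp l) (Real.measurable_exp.comp hfm) fun v => by
      rw [Function.comp_apply, abs_of_pos (Real.exp_pos _)]
      exact Real.exp_le_exp.2 (hfl v)
  have h1 : l * |∫ z, bit (a z) ∂μ - frequency a u| ≤ ∫ v, f v ∂π := by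
    rw [integral_const_mul]
    refine mul_le_mul_of_nonneg_left ?_ hl
    have hi : Integrable (fun v => frequency a v) π :=
      integrable_of_mem_Icc (b := 1) (measurable_frequency ha) fun v => by
        rw [abs_of_nonneg (frequency_nonneg _ _)]
        exact frequency_le_one _ _
    rw [← integral_frequency μ ha hm, abs_sub_comm]
    have : frequency a u - ∫ v, frequency a v ∂π = ∫ v, (frequency a u - frequency a v) ∂π := by
      rw [integral_sub (integrable_const _) hi]
      simp
    rw [this]
    exact abs_integral_le_integral_abs
  have h2 : Real.exp (∫ v, f v ∂π) ≤ ∫ v, Real.exp (f v) ∂π :=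
    convexOn_exp.map_integral_le Real.continuous_exp.continuousOn isClosed_univ
      (Filter.Eventually.of_forall fun _ => Set.mem_univ _) hfi hei
  calc _ ≤ ENNReal.ofReal (∫ v, Real.exp (f v) ∂π) :=
        ENNReal.ofReal_le_ofReal ((Real.exp_le_exp.2 h1).trans h2)
    _ = ∫⁻ v, ENNReal.ofReal (Real.exp (f v)) ∂π :=
        ofReal_integral_eq_lintegral_ofReal hei
          (Filter.Eventually.of_forall fun _ => (Real.exp_pos _).le)
    _ ≤ _ := by
        refine lintegral_mono fun v => ENNReal.ofReal_le_ofReal (Real.exp_le_exp.2 ?_)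
        exact mul_le_mul_of_nonneg_left (abs_frequency_sub_le_maxFrequencyGap haA u v) hl

/-- A uniform deviation inequality of **Vapnik and Chervonenkis**. -/
theorem measure_exists_lt_abs_integral_sub_frequency_le {A : Set (Z → Bool)} {N : ℕ}
    (hAm : ∀ a ∈ A, Measurable a) (hA : HasDifferencePatterns A m N) (hm : 0 < m)
    {l : ℝ} (hl : 0 ≤ l) (ε : ℝ)
    (hmeas : AEMeasurable (fun p : (Fin m → Z) × (Fin m → Z) => maxFrequencyGap A p.1 p.2)
      ((Measure.pi fun _ => μ).prod (Measure.pi fun _ => μ))) :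
    (Measure.pi fun _ : Fin m => μ) {u | ∃ a ∈ A, ε < |∫ z, bit (a z) ∂μ - frequency a u|} ≤
      ENNReal.ofReal (2 * N * Real.exp (l ^ 2 / (2 * m) - l * ε)) := by
  rcases A.eq_empty_or_nonempty with rfl | hne
  · simp
  set π := Measure.pi fun _ : Fin m => μ
  let f : (Fin m → Z) × (Fin m → Z) → ENNReal := fun p =>
    ENNReal.ofReal (Real.exp (l * maxFrequencyGap A p.1 p.2))
  have hf : AEMeasurable f (π.prod π) := by
    dsimp only [f]
    fun_prop
  -- The deviation event need not be measurable. It lies in a superlevel set of an a.e. measurable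
  -- integral over the ghost sample, to which Markov's inequality applies.
  have hsub : {u | ∃ a ∈ A, ε < |∫ z, bit (a z) ∂μ - frequency a u|} ⊆
      {u | ENNReal.ofReal (Real.exp (l * ε)) ≤ ∫⁻ v, f (u, v) ∂π} := by
    rintro u ⟨a, ha, hlt⟩
    refine le_trans (ENNReal.ofReal_le_ofReal (Real.exp_le_exp.2 ?_))
      (exp_abs_integral_sub_frequency_le μ ha (hAm a ha) hm hl u)
    exact mul_le_mul_of_nonneg_left hlt.le hl
  have hpos : ENNReal.ofReal (Real.exp (l * ε)) ≠ 0 := by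
    simpa using Real.exp_pos _
  calc _ ≤ π {u | ENNReal.ofReal (Real.exp (l * ε)) ≤ ∫⁻ v, f (u, v) ∂π} := measure_mono hsub
    _ ≤ (∫⁻ u, ∫⁻ v, f (u, v) ∂π ∂π) / ENNReal.ofReal (Real.exp (l * ε)) :=
      meas_ge_le_lintegral_div hf.lintegral_prod_right' hpos ENNReal.ofReal_ne_top
    _ = (∫⁻ p, f p ∂(π.prod π)) / ENNReal.ofReal (Real.exp (l * ε)) := by
      rw [lintegral_prod _ hf]
    _ ≤ ENNReal.ofReal (2 * N * Real.exp (l ^ 2 / (2 * m))) /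
        ENNReal.ofReal (Real.exp (l * ε)) := by
      gcongr
      exact lintegral_exp_maxFrequencyGap_le μ hA hne hm hl hmeas
    _ = _ := by
      rw [← ENNReal.ofReal_div_of_pos (Real.exp_pos _), mul_div_assoc, ← Real.exp_sub]

end UniformDeviation

/-! ### Choice of constants and degenerate cases -/

variable {X : Type*}

/-- Two distinct functions would shatter a point where they differ. -/
lemma eq_of_vcDim_le_zero {H : Set (X → Bool)} (hd : vcDim H ≤ (0 : ℕ)) {g g' : X → Bool}
    (hg : g ∈ H) (hg' : g' ∈ H) : g = g' := by
  classical
  by_contra hne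
  obtain ⟨x, hx⟩ := Function.ne_iff.1 hne
  have hsh : Shatters H {x} := by
    intro t ht
    have h : ∀ b : Bool, ∃ f ∈ H, f x = b := by
      intro b
      by_cases hb : g x = b
      · exact ⟨g, hg, hb⟩
      · refine ⟨g', hg', ?_⟩
        revert hb hx
        cases g x <;> cases g' x <;> cases b <;> simp
    obtain ⟨f, hf, hfx⟩ := h (decide (x ∈ t))
    refine ⟨f, hf, fun y hy => ?_⟩
    rw [Finset.mem_singleton.1 hy, hfx, decide_eq_true_iff]
  simpa using card_le_of_vcDim_le hd hsh

/-- This absorbs the pattern count into the exponential; it fails for `m = 1` with `d = 1`, and for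
`d = 0`. -/
lemma patterns_bound {d m : ℕ} (hd : 0 < d) (hm : 2 ≤ m) :
    3 * (2 * m + 1) ^ (2 * d) ≤ (2 * m) ^ (4 * d) := by
  have hbase : 3 * (2 * m + 1) ^ 2 ≤ (2 * m) ^ 4 := by
    have h1 : 2 * (2 * m + 1) ≤ (2 * m) ^ 2 := by nlinarith
    calc 3 * (2 * m + 1) ^ 2 ≤ (2 * (2 * m + 1)) ^ 2 := by nlinarith
      _ ≤ ((2 * m) ^ 2) ^ 2 := Nat.pow_le_pow_left h1 2
      _ = _ := by ring
  calc 3 * (2 * m + 1) ^ (2 * d) ≤ 3 ^ d * (2 * m + 1) ^ (2 * d) :=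
        Nat.mul_le_mul_right _ (Nat.le_self_pow hd.ne' 3)
    _ = (3 * (2 * m + 1) ^ 2) ^ d := by rw [mul_pow, pow_mul]
    _ ≤ ((2 * m) ^ 4) ^ d := Nat.pow_le_pow_left hbase d
    _ = _ := by rw [← pow_mul]

/-- The probability of drawing an input at which `a` is true. -/
noncomputable def inputProb [MeasurableSpace X] (D : Measure (X × Verdict)) (a : X → Bool) : ℝ :=
  ∫ p, bit (a p.1) ∂D

/-- The accuracy with which the frequencies in a sample estimate probabilities. -/
noncomputable def deviationRadius (d m : ℕ) (δ : ℝ) : ℝ :=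
  √((2 * d * Real.log (2 * m) + Real.log (2 / δ)) / m)

lemma log_two_div_pos {δ : ℝ} (hδ : δ ∈ Set.Ioo (0 : ℝ) 1) : Real.log 2 < Real.log (2 / δ) :=
  Real.log_lt_log two_pos ((lt_div_iff₀ hδ.1).2 (by linarith [hδ.2]))

lemma mul_deviationRadius_sq {d m : ℕ} (hm : 0 < m) {δ : ℝ} (hδ : δ ∈ Set.Ioo (0 : ℝ) 1) :
    m * deviationRadius d m δ ^ 2 = 2 * d * Real.log (2 * m) + Real.log (2 / δ) := by
  have hm' : (1 : ℝ) ≤ m := by exact_mod_cast hm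
  have h1 : 0 ≤ Real.log (2 * m) := Real.log_nonneg (by linarith)
  have h2 : 0 < Real.log (2 / δ) := (Real.log_pos one_lt_two).trans (log_two_div_pos hδ)
  rw [deviationRadius, Real.sq_sqrt (by positivity)]
  field_simp

lemma two_mul_patterns_mul_exp_le {d m : ℕ} (hd : 0 < d) (hm : 2 ≤ m) {δ : ℝ}
    (hδ : δ ∈ Set.Ioo (0 : ℝ) 1) :
    2 * (3 * (2 * m + 1) ^ (2 * d) : ℕ) *
      Real.exp (-(2 * (2 * d * Real.log (2 * m) + Real.log (2 / δ)))) ≤ δ / 2 := by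
  have hm' : (0 : ℝ) < 2 * m := by positivity
  have h2 : (0 : ℝ) < 2 / δ := div_pos two_pos hδ.1
  have he : Real.exp (-(2 * (2 * d * Real.log (2 * m) + Real.log (2 / δ)))) =
      ((2 * m : ℝ) ^ (4 * d))⁻¹ * (δ / 2) ^ 2 := by
    have : 2 * (2 * d * Real.log (2 * m) + Real.log (2 / δ)) =
        (4 * d : ℕ) * Real.log (2 * m) + (2 : ℕ) * Real.log (2 / δ) := by
      push_cast
      ring
    rw [Real.exp_neg, this, Real.exp_add, Real.exp_nat_mul, Real.exp_nat_mul, Real.exp_log hm',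
      Real.exp_log h2, mul_inv, ← inv_pow, ← inv_pow (2 / δ), inv_div]
  have hN : ((3 * (2 * m + 1) ^ (2 * d) : ℕ) : ℝ) ≤ (2 * m : ℝ) ^ (4 * d) := by
    exact_mod_cast patterns_bound hd hm
  rw [he]
  calc 2 * ((3 * (2 * m + 1) ^ (2 * d) : ℕ) : ℝ) * (((2 * m : ℝ) ^ (4 * d))⁻¹ * (δ / 2) ^ 2)
      ≤ 2 * (2 * m : ℝ) ^ (4 * d) * (((2 * m : ℝ) ^ (4 * d))⁻¹ * (δ / 2) ^ 2) := by gcongr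
    _ = 2 * (δ / 2) ^ 2 := by field_simp
    -- The square of `δ / 2` pays for the prefactor `2`, because `δ < 1`.
    _ ≤ δ / 2 := by nlinarith [hδ.1, hδ.2]

lemma abs_frequency_sub_le_empiricalDivergence {m : ℕ} {H : Verdict → Set (X → Bool)}
    {a : X → Bool} (ha : a ∈ symmDiffClass H) (u v : Fin m → X) :
    |frequency a u - frequency a v| ≤ 1 / 2 * empiricalDivergence H u v := by
  refine (abs_frequency_sub_le_maxFrequencyGap ha u v).trans_eq ?_
  rw [maxFrequencyGap, empiricalDivergence]
  ring

variable [MeasurableSpace X]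

lemma measurable_xor {g g' : X → Bool} (hg : Measurable g) (hg' : Measurable g') :
    Measurable fun x => xor (g x) (g' x) :=
  (Measurable.of_discrete (f := fun b : Bool × Bool => xor b.1 b.2)).comp (hg.prodMk hg')

lemma measurable_of_mem_symmDiffClass {H : Verdict → Set (X → Bool)}
    (hH : ∀ i, ∀ g ∈ H i, Measurable g) {a : X → Bool} (ha : a ∈ symmDiffClass H) :
    Measurable a := by
  obtain ⟨i, g, hg, g', hg', rfl⟩ := ha
  exact measurable_xor (hH i g hg) (hH i g' hg')

lemma sampleLaw_deviation_le (D : Measure (X × Verdict)) [IsProbabilityMeasure D]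
    {H : Verdict → Set (X → Bool)} (hH : ∀ i, ∀ g ∈ H i, Measurable g) {d : ℕ}
    (hd : ∀ i, vcDim (H i) ≤ d) {m : ℕ} (hm : 0 < m) (hD : DivergenceMeasurable D H m) {δ : ℝ}
    (hδ : δ ∈ Set.Ioo (0 : ℝ) 1) :
    sampleLaw D m {U | ∃ a ∈ symmDiffClass H,
        2 * deviationRadius d m δ < |inputProb D a - frequency a (inputs U)|} ≤
      ENNReal.ofReal (δ / 2) := by
  set s := deviationRadius d m δ with hs
  have hs0 : 0 ≤ s := Real.sqrt_nonneg _
  -- For `d = 0` each class has at most one function, so every symmetric difference is identically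
  -- false.
  rcases Nat.eq_zero_or_pos d with rfl | hd0
  · have : {U : Fin m → X × Verdict | ∃ a ∈ symmDiffClass H,
        2 * s < |inputProb D a - frequency a (inputs U)|} = ∅ := by
      ext U
      simp only [Set.mem_ofPred_eq, Set.mem_empty_iff_false, iff_false, not_exists, not_and, not_lt]
      rintro a ⟨i, g, hg, g', hg', rfl⟩
      obtain rfl := eq_of_vcDim_le_zero (hd i) hg hg'
      simpa [inputProb, frequency, bit] using hs0
    simp [this]
  -- For `m = 1` the radius is vacuous: `s ^ 2 > log 2 > 1 / 4`, so `2 * s` exceeds every possible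
  -- deviation.
  rcases (show m = 1 ∨ 2 ≤ m by omega) with rfl | hm2
  · have : {U : Fin 1 → X × Verdict | ∃ a ∈ symmDiffClass H,
        2 * s < |inputProb D a - frequency a (inputs U)|} = ∅ := by
      ext U
      simp only [Set.mem_ofPred_eq, Set.mem_empty_iff_false, iff_false, not_exists, not_and, not_lt]
      intro a ha
      have hi := integrable_bit_comp D ((measurable_of_mem_symmDiffClass hH ha).comp measurable_fst)
      have h0 : 0 ≤ inputProb D a := integral_nonneg fun p => bit_nonneg _
      have h1 : inputProb D a ≤ 1 := by
        simpa [inputProb] using integral_mono hi (integrable_const 1) fun p => bit_le_one (a p.1)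
      have h2 : |inputProb D a - frequency a (inputs U)| ≤ 1 :=
        abs_sub_le_of_nonneg_of_le h0 h1 (frequency_nonneg _ _) (frequency_le_one _ _)
      have h3 := mul_deviationRadius_sq (d := d) one_pos hδ
      rw [← hs] at h3
      have h4 : 0 ≤ 2 * d * Real.log (2 * (1 : ℕ)) := by
        have := Real.log_nonneg (x := 2 * (1 : ℕ)) (by norm_num)
        positivity
      have h5 := log_two_div_pos hδ
      have h6 := Real.log_two_gt_d9
      push_cast at h3 h4
      nlinarith
    simp [this]
  let A : Set (X × Verdict → Bool) := (fun a p => a p.1) '' symmDiffClass H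
  have hAm : ∀ a ∈ A, Measurable a := by
    rintro _ ⟨a, ha, rfl⟩
    exact (measurable_of_mem_symmDiffClass hH ha).comp measurable_fst
  have hA : HasDifferencePatterns A m (3 * (2 * m + 1) ^ (2 * d)) := by
    intro u v
    obtain ⟨B, hB, hB1, hmem⟩ := hasDifferencePatterns_symmDiffClass hd m (inputs u) (inputs v)
    refine ⟨B, hB, hB1, ?_⟩
    rintro _ ⟨a, ha, rfl⟩
    exact hmem a ha
  have hgap : ∀ u v : Fin m → X × Verdict,
      maxFrequencyGap A u v = 1 / 2 * empiricalDivergence H (inputs u) (inputs v) := by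
    intro u v
    rw [maxFrequencyGap, empiricalDivergence, Set.image_image, ← mul_assoc]
    norm_num
    rfl
  have hmeas : AEMeasurable (fun p : (Fin m → X × Verdict) × (Fin m → X × Verdict) =>
      maxFrequencyGap A p.1 p.2) ((Measure.pi fun _ => D).prod (Measure.pi fun _ => D)) := by
    simp only [hgap]
    exact AEMeasurable.const_mul hD _
  have hm' : (0 : ℝ) < m := Nat.cast_pos.2 hm
  calc _ ≤ (Measure.pi fun _ : Fin m => D)
        {u | ∃ a ∈ A, 2 * s < |∫ z, bit (a z) ∂D - frequency a u|} := by
        refine measure_mono ?_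
        rintro U ⟨a, ha, h⟩
        exact ⟨_, ⟨a, ha, rfl⟩, h⟩
    -- With `ε = 2 * s`, the choice `l = ε * m` minimizes the exponent, which becomes `-2 * m * s ^
    -- 2`.
    _ ≤ _ := measure_exists_lt_abs_integral_sub_frequency_le D hAm hA hm
        (l := 2 * s * m) (by positivity) (2 * s) hmeas
    _ ≤ ENNReal.ofReal (δ / 2) := by
        refine ENNReal.ofReal_le_ofReal ((le_of_eq ?_).trans
          (two_mul_patterns_mul_exp_le hd0 hm2 hδ))
        rw [← mul_deviationRadius_sq hm hδ, ← hs]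
        congr 2
        field_simp
        ring

/-! ### Triangle inequalities for the losses -/

section Losses

variable (D : Measure (X × Verdict)) [IsProbabilityMeasure D]

lemma integrable_componentLoss (i : Verdict) {g : X → Bool} (hg : Measurable g) :
    Integrable (fun p : X × Verdict => |bit (g p.1) - bit (decide (p.2 = i))|) D := by
  have hi : Measurable fun p : X × Verdict => decide (p.2 = i) :=
    (measurable_from_top (f := fun y : Verdict => decide (y = i))).comp measurable_snd
  exact ((integrable_bit_comp D (hg.comp measurable_fst)).sub (integrable_bit_comp D hi)).abs

lemma integrable_bit_xor {g g' : X → Bool} (hg : Measurable g) (hg' : Measurable g') :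
    Integrable (fun p : X × Verdict => bit (xor (g p.1) (g' p.1))) D :=
  integrable_bit_comp D ((measurable_xor hg hg').comp measurable_fst)

lemma componentLoss_le_add (i : Verdict) {g g' : X → Bool} (hg : Measurable g)
    (hg' : Measurable g') :
    componentLoss D i g ≤ componentLoss D i g' + inputProb D fun x => xor (g x) (g' x) := by
  unfold componentLoss inputProb
  rw [← integral_add (integrable_componentLoss D i hg') (integrable_bit_xor D hg hg')]
  refine integral_mono (integrable_componentLoss D i hg)
    ((integrable_componentLoss D i hg').add (integrable_bit_xor D hg hg')) fun p => ?_
  dsimp only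
  cases g p.1 <;> cases g' p.1 <;> cases decide (p.2 = i) <;> norm_num [bit]

lemma inputProb_xor_le_add (i : Verdict) {g g' : X → Bool} (hg : Measurable g)
    (hg' : Measurable g') :
    inputProb D (fun x => xor (g x) (g' x)) ≤ componentLoss D i g + componentLoss D i g' := by
  unfold componentLoss inputProb
  rw [← integral_add (integrable_componentLoss D i hg) (integrable_componentLoss D i hg')]
  refine integral_mono (integrable_bit_xor D hg hg')
    ((integrable_componentLoss D i hg).add (integrable_componentLoss D i hg')) fun p => ?_
  dsimp only
  cases g p.1 <;> cases g' p.1 <;> cases decide (p.2 = i) <;> norm_num [bit]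

lemma misclassification_le_add (D' : Measure (X × Verdict)) [IsProbabilityMeasure D']
    {H : Verdict → Set (X → Bool)} (hH : ∀ i, ∀ g ∈ H i, Measurable g) {c : ℝ}
    (hc : ∀ a ∈ symmDiffClass H, |inputProb D a - inputProb D' a| ≤ c)
    {h : Verdict → X → Bool} (hh : h ∈ portfolios H) :
    misclassification D' h ≤ misclassification D h + 3 / 2 * c +
      1 / 2 * optimalCombinedError D D' H := by
  have hinf : 2 * (misclassification D' h - misclassification D h - 3 / 2 * c) ≤
      optimalCombinedError D D' H := by
    -- The portfolio `h` itself shows that the infimum is over a nonempty set.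
    refine le_csInf ⟨_, h, hh, rfl⟩ ?_
    rintro _ ⟨k, hk, rfl⟩
    have hi : ∀ i, componentLoss D' i (h i) ≤ componentLoss D i (h i) + c +
        (componentLoss D i (k i) + componentLoss D' i (k i)) := by
      intro i
      have hmh := hH i _ (hh.1 i)
      have hmk := hH i _ (hk.1 i)
      have h1 := componentLoss_le_add D' i hmh hmk
      have h2 := inputProb_xor_le_add D i hmh hmk
      have h3 := hc _ ⟨i, _, hh.1 i, _, hk.1 i, rfl⟩
      linarith [(abs_le.1 h3).1]
    have hsum := Finset.sum_le_sum fun i (_ : i ∈ Finset.univ) => hi i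
    have hcard : ∑ _i : Verdict, c = 3 * c := by
      rw [Finset.sum_const, nsmul_eq_mul]
      rfl
    rw [Finset.sum_add_distrib, Finset.sum_add_distrib, hcard] at hsum
    unfold misclassification
    dsimp only
    linarith
  linarith

end Losses

end Judge

/-! ### Assembly of the generalization bound -/

theorem mainTheorem1 {X : Type*} [MeasurableSpace X]
    (DS DT : Measure (X × Judge.Verdict)) [IsProbabilityMeasure DS] [IsProbabilityMeasure DT]
    (H : Judge.Verdict → Set (X → Bool)) (hH : ∀ i, ∀ g ∈ H i, Measurable g)
    (d : ℕ) (hd : ∀ i, Judge.vcDim (H i) ≤ d)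
    (m : ℕ) (hm : 0 < m)
    (hS : Judge.DivergenceMeasurable DS H m) (hT : Judge.DivergenceMeasurable DT H m)
    (δ : ℝ) (hδ : δ ∈ Set.Ioo (0 : ℝ) 1) :
    ((Judge.sampleLaw DS m).prod (Judge.sampleLaw DT m))
      {U | ¬ ∀ h ∈ Judge.portfolios H,
        Judge.misclassification DT h ≤
          Judge.misclassification DS h
            + (3 / 4) * Judge.empiricalDivergence H (Judge.inputs U.1) (Judge.inputs U.2)
            + 6 * √((2 * d * Real.log (2 * m) + Real.log (2 / δ)) / m)
            + (1 / 2) * Judge.optimalCombinedError DS DT H}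
      ≤ ENNReal.ofReal δ := by
  set s := Judge.deviationRadius d m δ
  let bad : MeasureTheory.Measure (X × Judge.Verdict) → Set (Fin m → X × Judge.Verdict) :=
    fun D => {U | ∃ a ∈ Judge.symmDiffClass H,
      2 * s < |Judge.inputProb D a - Judge.frequency a (Judge.inputs U)|}
  have hprobS : IsProbabilityMeasure (Judge.sampleLaw DS m) := by
    unfold Judge.sampleLaw
    infer_instance
  have hprobT : IsProbabilityMeasure (Judge.sampleLaw DT m) := by
    unfold Judge.sampleLaw
    infer_instance
  calc _ ≤ ((Judge.sampleLaw DS m).prod (Judge.sampleLaw DT m))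
        (bad DS ×ˢ Set.univ ∪ Set.univ ×ˢ bad DT) := by
        refine measure_mono fun U hU => ?_
        by_contra hgood
        simp only [bad, Set.mem_union, Set.mem_prod, Set.mem_univ, Set.mem_ofPred_eq, and_true,
          true_and, not_or, not_exists, not_and, not_lt] at hgood
        refine hU fun h hh => ?_
        have hc : ∀ a ∈ Judge.symmDiffClass H, |Judge.inputProb DS a - Judge.inputProb DT a| ≤
            1 / 2 * Judge.empiricalDivergence H (Judge.inputs U.1) (Judge.inputs U.2) +
              4 * s := by
          intro a ha
          have h1 := abs_le.1 (hgood.1 a ha)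
          have h2 := abs_le.1 (hgood.2 a ha)
          have h3 := abs_le.1 (Judge.abs_frequency_sub_le_empiricalDivergence ha
            (Judge.inputs U.1) (Judge.inputs U.2))
          exact abs_le.2 ⟨by linarith [h1.1, h2.2, h3.1], by linarith [h1.2, h2.1, h3.2]⟩
        have hmain := Judge.misclassification_le_add DS DT hH hc hh
        rw [show √((2 * d * Real.log (2 * m) + Real.log (2 / δ)) / m) = s from rfl]
        linarith
    _ ≤ Judge.sampleLaw DS m (bad DS) + Judge.sampleLaw DT m (bad DT) := by
        -- Subadditivity and the product formula for rectangles hold for arbitrary sets, so the bad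
        -- events need no measurability.
        refine (measure_union_le _ _).trans_eq ?_
        rw [Measure.prod_prod, Measure.prod_prod, measure_univ, measure_univ, mul_one, one_mul]
    _ ≤ ENNReal.ofReal (δ / 2) + ENNReal.ofReal (δ / 2) :=
        add_le_add (Judge.sampleLaw_deviation_le DS hH hd hm hS hδ)
          (Judge.sampleLaw_deviation_le DT hH hd hm hT hδ)
    _ = ENNReal.ofReal δ := by
        rw [← ENNReal.ofReal_add (half_pos hδ.1).le (half_pos hδ.1).le, add_halves]
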